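/- Let $\mathcal M=\{X^{(n)}\}_{n=-\infty}^{\infty}$ be an irreducible homogeneous Markov chain with finite state space $\mathscr X$, transition matrix $\mathbf P=[p_{i,j}]_{i,j\in\mathscr X}$, invariant distribution $\pi=[p_j]_{j\in\mathscr X}$ and arbitrary initial distribution. (Irreducible means that there is no $\emptyset\neq A\subsetneq\mathscr X$ with $\mathbf P_{A,A^c}=\mathbf 0$, where $\mathbf P_{A,B}=[p_{i,j}]_{i\in A,j\in B}$.) Let $H(\mathbf P|\pi)=-\sum_{i,j}p_ip_{i,j}\log_2p_{i,j}$, with $0\log_2 0=0$. For a finite sequence $\mathbf x$, let $N(i,j;\mathbf x)$ be the number of occurrences of $[i,j]$ as two consecutive entries of $\mathbf x$, and let $N(i;\mathbf x)=\sum_jN(i,j;\mathbf x)$. For $\epsilon>0$, a sequence $\mathbf x$ of length $n\ge 2$ over the state space of an irreducible stochastic matrix $\mathbf P$ with invariant distribution $\pi$ is strongly Markov $\epsilon$-typical with respect to $\mathbf P$ if, for all states $i,j$, $$\left|\frac{N(i,j;\mathbf x)}{N(i;\mathbf x)}-p_{i,j}\right|<\epsilon\quad\text{and}\quad\left|\frac{N(i;\mathbf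 x)}{n}-p_i\right|<\epsilon ,$$ or $$\sum_{i,j}\left|\frac{N(i,j;\mathbf x)}{N(i;\mathbf x)}-p_{i,j}\right|<\epsilon\quad\text{and}\quad\sum_i\left|\frac{N(i;\mathbf x)}{n}-p_i\right|<\epsilon ,$$ with the convention $0/0=0$. For nonempty $A\subseteq\mathscr X$, let $$\mathbf S_A=\mathbf P_{A,A}+\mathbf P_{A,A^c}\left(\mathbf 1-\mathbf P_{A^c,A^c}\right)^{-1}\mathbf P_{A^c,A}$$ be the stochastic complement of $\mathbf P_{A,A}$ in $\mathbf P$; its invariant distribution is $\pi_A=\left[p_i/\sum_{j\in A}p_j\right]_{i\in A}$. For a sequence $\mathbf x$ over $\mathscr X$, let $\mathbf x_A$ be the subsequence of the entries of $\mathbf x$ that belong to $A$, in the original order. A sequence $\mathbf x\in\mathscr X^n$ with $n\ge 2|\mathscr X|$ is Supremus $\epsilon$-typical with respect to $\mathbf P$ if, for every nonempty $A\subseteq\mathscr X$, $\mathbf x_A$ has length at least $2$ and is strongly Markov $\epsilon$-typical with respect to $\mathbf S_A$ (and $\pi_A$). Let $\mathcal S_\epsilon(n,\mathbf P)\subseteq\mathscr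 X^n$ be the set of these sequences, and let $\mathbf X=[X^{(1)},\dots,X^{(n)}]$. Then for every $\eta>0$ there exist $\epsilon_0>0$ and $N_0\in\mathbb N^+$ such that, for every $0<\epsilon<\epsilon_0$: 1. for all $n>N_0$ and all $\mathbf x\in\mathcal S_\epsilon(n,\mathbf P)$, $$\Pr\{\mathbf X=\mathbf x\}<2^{-n(H(\mathbf P|\pi)-\eta)},$$ and, if moreover $\Pr\{\mathbf X=\mathbf x\}>0$, then $$2^{-n(H(\mathbf P|\pi)+\eta)}<\Pr\{\mathbf X=\mathbf x\};$$ 2. there exists $N_1\in\mathbb N$, which may depend on $\epsilon$, such that $\Pr\{\mathbf X\notin\mathcal S_\epsilon(n,\mathbf P)\}<\eta$ for all $n>N_1$; 3. for all $n>N_0$, $|\mathcal S_\epsilon(n,\mathbf P)|<2^{n(H(\mathbf P|\pi)+\eta)}$. -/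

import Mathlib

open MeasureTheory ProbabilityTheory

namespace SupremusTypicality

noncomputable section

variable {S : Type*} [Fintype S] [DecidableEq S]

/-- The random block `[X⁽¹⁾, …, X⁽ⁿ⁾]`, as a function `Fin n → S`; the `k`-th entry (counted
from zero) is `X⁽ᵏ⁺¹⁾`. -/
def block {Ω S : Type*} (X : ℤ → Ω → S) (n : ℕ) (ω : Ω) : Fin n → S :=
  fun k => X ((k : ℤ) + 1) ω

/-- `X` is a homogeneous Markov chain on the finite state space `S` with transition matrix `P`
(with an arbitrary initial distribution): `P` is a stochastic matrix; for every `n ≥ 1` the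
conditional law of `X⁽ⁿ⁺¹⁾` given `X⁽¹⁾, …, X⁽ⁿ⁾` is its conditional law given `X⁽ⁿ⁾` alone; and
the latter is given by `P`. Here `n = m + 1`. -/
structure IsMarkovChain {Ω : Type*} [MeasurableSpace Ω] [MeasurableSpace S]
    (μ : Measure Ω) (X : ℤ → Ω → S) (P : Matrix S S ℝ) : Prop where
  measurable : ∀ n, Measurable (X n)
  stochastic : P ∈ Matrix.rowStochastic ℝ S
  markov : ∀ (m : ℕ) (h : Fin (m + 1) → S) (j : S),
    μ {ω | block X (m + 1) ω = h} ≠ 0 →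
      (μ[|{ω | block X (m + 1) ω = h}]).real {ω | X ((m : ℤ) + 2) ω = j} =
        (μ[|{ω | X ((m : ℤ) + 1) ω = h (Fin.last m)}]).real {ω | X ((m : ℤ) + 2) ω = j}
  transition : ∀ (m : ℕ) (i j : S),
    μ {ω | X ((m : ℤ) + 1) ω = i} ≠ 0 →
      (μ[|{ω | X ((m : ℤ) + 1) ω = i}]).real {ω | X ((m : ℤ) + 2) ω = j} = P i j

/-- A (stochastic) matrix is irreducible if `P_{A, Aᶜ} = 0` for no nonempty proper subset `A`. -/
def IsIrreducible (P : Matrix S S ℝ) : Prop :=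
  ∀ A : Finset S, A.Nonempty → A ≠ Finset.univ → ¬ ∀ i ∈ A, ∀ j ∉ A, P i j = 0

/-- `π` is an invariant distribution of `P`. -/
def IsInvariant (P : Matrix S S ℝ) (π : S → ℝ) : Prop :=
  π ∈ stdSimplex ℝ S ∧ Matrix.vecMul π P = π

/-- The conditional entropy `H(P | π)`, in bits. -/
def condEntropy (P : Matrix S S ℝ) (π : S → ℝ) : ℝ :=
  -∑ i, ∑ j, π i * P i j * Real.logb 2 (P i j)

/-- `N(i, j; x)`: the number of consecutive occurrences of `[i, j]` in `x`. -/
def pairCount (x : List S) (i j : S) : ℕ :=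
  (x.zip x.tail).count (i, j)

/-- `N(i; x) = ∑ j, N(i, j; x)`. -/
def stateCount (x : List S) (i : S) : ℕ :=
  ∑ j, pairCount x i j

/-- `x`, of length at least two, is strongly Markov `ε`-typical for the transition matrix `P`
with invariant distribution `π`. -/
def IsStronglyTypical (P : Matrix S S ℝ) (π : S → ℝ) (ε : ℝ) (x : List S) : Prop :=
  2 ≤ x.length ∧
    (((∀ i j, |(pairCount x i j : ℝ) / stateCount x i - P i j| < ε) ∧
        ∀ i, |(stateCount x i : ℝ) / x.length - π i| < ε) ∨
      ((∑ i, ∑ j, |(pairCount x i j : ℝ) / stateCount x i - P i j| < ε) ∧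
        ∑ i, |(stateCount x i : ℝ) / x.length - π i| < ε))

/-- The stochastic complement
`S_A = P_{A,A} + P_{A,Aᶜ} (1 - P_{Aᶜ,Aᶜ})⁻¹ P_{Aᶜ,A}`. -/
def stochasticComplement (P : Matrix S S ℝ) (A : Finset S) : Matrix A A ℝ :=
  let PAA : Matrix A A ℝ := P.submatrix (↑) (↑)
  let PAB : Matrix A ↥(Aᶜ) ℝ := P.submatrix (↑) (↑)
  let PBA : Matrix ↥(Aᶜ) A ℝ := P.submatrix (↑) (↑)
  let PBB : Matrix ↥(Aᶜ) ↥(Aᶜ) ℝ := P.submatrix (↑) (↑)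
  PAA + PAB * (1 - PBB)⁻¹ * PBA

/-- `π_A`: the vector `π` restricted to `A` and normalized. -/
def restrictedDistribution (π : S → ℝ) (A : Finset S) : A → ℝ :=
  fun i => π i / ∑ j ∈ A, π j

/-- `x_A`: the subsequence of the entries of `x` that lie in `A`, in the original order. -/
def subsequence (A : Finset S) (x : List S) : List A :=
  x.filterMap fun i => if h : i ∈ A then some ⟨i, h⟩ else none

/-- The set of all Supremus `ε`-typical sequences of length `n` for the transition matrix `P`
with invariant distribution `π`. -/
def supremusTypicalSet (P : Matrix S S ℝ) (π : S → ℝ) (ε : ℝ) (n : ℕ) : Set (Fin n → S) :=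
  {x | 2 * Fintype.card S ≤ n ∧
    ∀ A : Finset S, A.Nonempty →
      IsStronglyTypical (stochasticComplement P A) (restrictedDistribution π A) ε
        (subsequence A (List.ofFn x))}

end

end SupremusTypicality

/-!
The entropy bounds use only that the full sequence is typical. Then every transition count
`N(i, j; x)` is within `2 ε n` of `n π_i p_{i,j}` (`abs_pairCount_sub_le`), and the probability of
`x` is an initial factor, bounded away from zero where it is positive, times
`∏ p_{i,j} ^ N(i, j; x)`; taking logarithms gives `IsMarkovChain.measureReal_block_bounds`. A
typical sequence may contain a few transitions of probability zero, so the size of the typical set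
cannot be read off from these probabilities. Instead the sequences are weighted with a stochastic
matrix `Q`, all of whose entries are positive and whose cross entropy relative to `P` exceeds
`H(P | π)` by at most `η / 4` (`exists_pos_stochastic`). All weights together add up to `|S|` and,
for small `ε`, each typical sequence has weight at least `2 ^ (-n (H(P | π) + 3 η / 4))`.

That typical sequences have high probability is proved by a second moment argument, which does
not need aperiodicity or an ergodic theorem. For states `i` and `j` of `A`, let `h s` be the
probability that the chain started at `s` enters `A` at `j`. It equals the indicator of `j` on `A`
and satisfies `h = P h` off `A`, while `P h` on `A` is the column of `j` in the stochastic
complement. Summing the martingale differences `h (X⁽ᵏ⁺¹⁾) - (P h) (X⁽ᵏ⁾)` over the times `k` at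
which the last visit to `A` was at `i`, the terms within each excursion telescope, and what
remains is `N(i, j; x_A) - S_A(i, j) N(i; x_A)` up to a bounded boundary term (`compensatedCount`).
Its second moment grows linearly, so by Chebyshev's inequality it is `o(n)` in probability. For `A` the
whole space this says that the empirical distribution is almost invariant, and by uniqueness of the
invariant distribution it is then close to `π` (`exists_abs_le_of_sum_eq_zero`,
`IsMarkovChain.whp_count_sub`). The two facts together give typicality for every `A`
(`IsMarkovChain.whp_isStronglyTypical`).
-/

namespace SupremusTypicality

/-! ### Transition counts along a path -/

section Counts

variable {S : Type*} [DecidableEq S]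

lemma pairCount_cons_cons (a b : S) (l : List S) (i j : S) :
    pairCount (a :: b :: l) i j = pairCount (b :: l) i j + if a = i ∧ b = j then 1 else 0 := by
  simp [pairCount, List.count_cons]

lemma pairCount_append_pair (l : List S) (a b i j : S) :
    pairCount (l ++ [a] ++ [b]) i j =
      pairCount (l ++ [a]) i j + if a = i ∧ b = j then 1 else 0 := by
  induction l with
  | nil => simp [pairCount, List.count_cons]
  | cons c l ih =>
    cases l with
    | nil => simp [pairCount, List.count_cons]; ring
    | cons d l =>
      simp only [List.cons_append] at ih ⊢
      rw [pairCount_cons_cons, pairCount_cons_cons, ih]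
      ring

lemma stateCount_append_singleton [Fintype S] (l : List S) (a i : S) :
    stateCount (l ++ [a]) i = l.count i := by
  induction l using List.reverseRecOn generalizing a with
  | nil => simp [stateCount, pairCount]
  | append_singleton l c ih =>
    have h := ih c
    simp only [stateCount] at h ⊢
    simp only [pairCount_append_pair, Finset.sum_add_distrib, h, List.count_append]
    by_cases hc : c = i <;> simp [hc]

lemma sum_pairCount_cons [Fintype S] (a : S) (l : List S) (j : S) :
    ∑ i, pairCount (a :: l) i j = l.count j := by
  induction l generalizing a with
  | nil => simp [pairCount]
  | cons b l ih =>
    simp only [pairCount_cons_cons, Finset.sum_add_distrib, ih, List.count_cons]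
    by_cases hb : b = j <;> simp [hb]

lemma pairCount_le_stateCount [Fintype S] (l : List S) (i j : S) :
    pairCount l i j ≤ stateCount l i :=
  Finset.single_le_sum (f := fun j => pairCount l i j) (fun _ _ => Nat.zero_le _)
    (Finset.mem_univ j)

lemma stateCount_le_length [Fintype S] (l : List S) (i : S) : stateCount l i ≤ l.length := by
  rcases List.eq_nil_or_concat l with rfl | ⟨l', a, rfl⟩
  · simp [stateCount, pairCount]
  · rw [List.concat_eq_append, stateCount_append_singleton]
    exact List.count_le_length.trans (by simp)

lemma count_eq_stateCount_add [Fintype S] (l : List S) (i : S) :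
    l.count i = stateCount l i + if l.getLast? = some i then 1 else 0 := by
  rcases List.eq_nil_or_concat l with rfl | ⟨l', a, rfl⟩
  · simp [stateCount, pairCount]
  · rw [List.concat_eq_append, stateCount_append_singleton]
    simp [List.count_append, List.count_cons]

lemma pairCount_map {T : Type*} [DecidableEq T] {f : T → S} (hf : Function.Injective f)
    (l : List T) (i j : T) : pairCount (l.map f) (f i) (f j) = pairCount l i j := by
  rw [pairCount, pairCount, ← List.map_tail, List.zip_map,
    ← Prod.map_apply f f i j]
  exact List.count_map_of_injective _ _ (hf.prodMap hf) _

lemma count_map_eq_stateCount_add {T : Type*} [DecidableEq T] [Fintype T] {f : T → S}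
    (hf : Function.Injective f) (l : List T) (i : T) :
    (l.map f).count (f i) = stateCount l i + if l.getLast? = some i then 1 else 0 := by
  rw [List.count_map_of_injective _ _ hf, count_eq_stateCount_add]

/-! ### Subsequences of visits -/

lemma map_val_subsequence (A : Finset S) (l : List S) :
    (subsequence A l).map Subtype.val = l.filter (· ∈ A) := by
  induction l with
  | nil => rfl
  | cons a l ih =>
    by_cases h : a ∈ A <;> simp_all [subsequence]

lemma count_eq_stateCount_subsequence_add (A : Finset S) (l : List S) (i : A) :
    l.count (i : S) = stateCount (subsequence A l) i +
      if (subsequence A l).getLast? = some i then 1 else 0 := by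
  rw [← count_map_eq_stateCount_add Subtype.val_injective, map_val_subsequence,
    List.count_filter (by simp)]

lemma subsequence_append_of_mem {A : Finset S} (l : List S) {a : S} (h : a ∈ A) :
    subsequence A (l ++ [a]) = subsequence A l ++ [⟨a, h⟩] := by
  simp [subsequence, h]

lemma subsequence_append_of_notMem {A : Finset S} (l : List S) {a : S} (h : a ∉ A) :
    subsequence A (l ++ [a]) = subsequence A l := by
  simp [subsequence, h]

lemma pairCount_subsequence_univ [Fintype S] (l : List S) (i j : S) :
    pairCount (subsequence Finset.univ l) ⟨i, Finset.mem_univ i⟩ ⟨j, Finset.mem_univ j⟩ =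
      pairCount l i j := by
  rw [← pairCount_map Subtype.val_injective, map_val_subsequence]
  simp

lemma stateCount_subsequence_univ [Fintype S] (l : List S) (i : S) :
    stateCount (subsequence Finset.univ l) ⟨i, Finset.mem_univ i⟩ = stateCount l i := by
  simp only [stateCount, ← pairCount_subsequence_univ l i]
  exact Fintype.sum_equiv (Equiv.subtypeUnivEquiv Finset.mem_univ) _ _ fun _ => rfl

lemma length_subsequence (A : Finset S) (l : List S) :
    (subsequence A l).length = ∑ i ∈ A, l.count i := by
  rw [← List.length_map (f := Subtype.val), map_val_subsequence]
  induction l with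
  | nil => simp
  | cons a l ih =>
    simp only [List.count_cons, Finset.sum_add_distrib, ← ih]
    by_cases h : a ∈ A <;> simp [h]

lemma stochasticComplement_univ [Fintype S] (P : Matrix S S ℝ) (i j : S) :
    stochasticComplement P Finset.univ ⟨i, Finset.mem_univ i⟩ ⟨j, Finset.mem_univ j⟩ = P i j := by
  have : IsEmpty ↥((Finset.univ : Finset S)ᶜ) := ⟨fun x => by simpa using x.2⟩
  simp [stochasticComplement, Matrix.mul_apply]

end Counts

/-! ### Invariant and harmonic vectors of an irreducible matrix -/

section Irreducible

variable {S : Type*} [DecidableEq S] [Fintype S]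

lemma pos_of_vecMul_eq {P : Matrix S S ℝ} (hst : P ∈ Matrix.rowStochastic ℝ S)
    (hP : IsIrreducible P) {w : S → ℝ} (hw : ∀ i, 0 ≤ w i) (hinv : Matrix.vecMul w P = w)
    (hne : w ≠ 0) (i : S) : 0 < w i := by
  by_contra hi
  obtain ⟨k, hk⟩ := Function.ne_iff.mp hne
  refine hP (Finset.univ.filter fun i => 0 < w i)
    ⟨k, by simpa using lt_of_le_of_ne (hw k) (Ne.symm hk)⟩ (fun h => hi ?_) ?_
  · simpa using h.ge (Finset.mem_univ i)
  · intro a ha b hb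
    have ha' : 0 < w a := by simpa using ha
    have hb' : w b = 0 := le_antisymm (by simpa using hb) (hw b)
    have hsum : ∑ c, w c * P c b = 0 := by
      rw [← hb']; exact congrFun hinv b
    have h0 := (Finset.sum_eq_zero_iff_of_nonneg fun c _ =>
      mul_nonneg (hw c) (Matrix.nonneg_of_mem_rowStochastic hst)).mp hsum a (Finset.mem_univ a)
    exact (mul_eq_zero.mp h0).resolve_left ha'.ne'

lemma IsInvariant.pos {P : Matrix S S ℝ} {π : S → ℝ} (hst : P ∈ Matrix.rowStochastic ℝ S)
    (hP : IsIrreducible P) (hπ : IsInvariant P π) (i : S) : 0 < π i := by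
  refine pos_of_vecMul_eq hst hP hπ.1.1 hπ.2 ?_ i
  rintro rfl
  simpa using hπ.1.2

/-- Invariant signed measures of total mass zero vanish: the absolute value of an invariant
vector is again invariant, so its positive and negative parts are both invariant, and each of
them is either zero or everywhere positive. -/
lemma eq_zero_of_vecMul_eq {P : Matrix S S ℝ} (hst : P ∈ Matrix.rowStochastic ℝ S)
    (hP : IsIrreducible P) {v : S → ℝ} (hinv : Matrix.vecMul v P = v)
    (hsum : ∑ i, v i = 0) : v = 0 := by
  have hle : ∀ j, |v j| ≤ ∑ i, |v i| * P i j := fun j => by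
    conv_lhs => rw [← hinv]
    refine (Finset.abs_sum_le_sum_abs _ _).trans_eq (Finset.sum_congr rfl fun i _ => ?_)
    rw [abs_mul, abs_of_nonneg (Matrix.nonneg_of_mem_rowStochastic hst)]
  have htot : ∑ j, |v j| = ∑ j, ∑ i, |v i| * P i j := by
    rw [Finset.sum_comm]
    simp [← Finset.mul_sum, Matrix.sum_row_of_mem_rowStochastic hst]
  have habs : ∀ j, ∑ i, |v i| * P i j = |v j| := fun j =>
    ((Finset.sum_eq_sum_iff_of_le fun j _ => hle j).mp htot j (Finset.mem_univ j)).symm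
  have hv : ∀ j, ∑ i, v i * P i j = v j := fun j => congrFun hinv j
  have hplus : Matrix.vecMul (fun i => |v i| + v i) P = fun i => |v i| + v i := by
    ext j
    change ∑ i, (|v i| + v i) * P i j = _
    simp only [add_mul, Finset.sum_add_distrib, habs, hv]
  have hminus : Matrix.vecMul (fun i => |v i| - v i) P = fun i => |v i| - v i := by
    ext j
    change ∑ i, (|v i| - v i) * P i j = _
    simp only [sub_mul, Finset.sum_sub_distrib, habs, hv]
  by_contra hne
  obtain ⟨k, hk⟩ := Function.ne_iff.mp hne
  have hpos := pos_of_vecMul_eq hst hP (fun i => by linarith [neg_abs_le (v i)]) hplus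
  have hneg := pos_of_vecMul_eq hst hP (fun i => by linarith [le_abs_self (v i)]) hminus
  by_cases h1 : (fun i => |v i| + v i) = 0
  · have hn : ∀ i ∈ Finset.univ, v i ≤ 0 := fun i _ => by
      have := congrFun h1 i
      simp only [Pi.zero_apply] at this
      linarith [abs_nonneg (v i)]
    exact hk ((Finset.sum_eq_zero_iff_of_nonpos hn).mp hsum k (Finset.mem_univ k))
  by_cases h2 : (fun i => |v i| - v i) = 0
  · have hn : ∀ i ∈ Finset.univ, 0 ≤ v i := fun i _ => by
      have := congrFun h2 i
      simp only [Pi.zero_apply] at this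
      linarith [abs_nonneg (v i)]
    exact hk ((Finset.sum_eq_zero_iff_of_nonneg hn).mp hsum k (Finset.mem_univ k))
  have ha := hpos h1 k
  have hb := hneg h2 k
  rcases abs_cases (v k) with h | h <;> linarith

/-- A vector of total mass `0` that is almost invariant is small: an injective linear map between
finite-dimensional spaces is bounded below. -/
lemma exists_abs_le_of_sum_eq_zero {P : Matrix S S ℝ} (hst : P ∈ Matrix.rowStochastic ℝ S)
    (hP : IsIrreducible P) : ∃ K : ℝ, 0 < K ∧ ∀ (v : S → ℝ) (δ : ℝ), 0 ≤ δ → ∑ i, v i = 0 →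
      (∀ j, |v j - ∑ i, v i * P i j| ≤ δ) → ∀ i, |v i| ≤ K * δ := by
  let T : (S → ℝ) →ₗ[ℝ] (S → ℝ) × ℝ :=
    (LinearMap.id - Matrix.vecMulLinear P).prod (∑ i, LinearMap.proj i)
  have hT : ∀ v, T v = (v - Matrix.vecMul v P, ∑ i, v i) := fun v => by
    simp [T]
  have hker : LinearMap.ker T = ⊥ := by
    rw [LinearMap.ker_eq_bot']
    intro v hv
    rw [hT, Prod.mk_eq_zero, sub_eq_zero] at hv
    exact eq_zero_of_vecMul_eq hst hP hv.1.symm hv.2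
  obtain ⟨K, hK, hlip⟩ := T.exists_antilipschitzWith hker
  refine ⟨K, hK, fun v δ hδ hsum hv i => ?_⟩
  have h1 : ‖v‖ ≤ K * ‖T v‖ := by
    simpa using hlip.le_mul_dist v 0
  have h2 : ‖T v‖ ≤ δ := by
    rw [hT, hsum, Prod.norm_mk, norm_zero]
    exact max_le ((pi_norm_le_iff_of_nonneg hδ).mpr hv) hδ
  exact (norm_le_pi_norm v i).trans (h1.trans (mul_le_mul_of_nonneg_left h2 K.coe_nonneg))

/-- The chain leaves `Aᶜ` almost surely, by the maximum principle: the states where a vector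
fixed by `P_{Aᶜ, Aᶜ}` has maximal modulus would form a closed class. -/
lemma isUnit_one_sub_submatrix_compl {P : Matrix S S ℝ} (hst : P ∈ Matrix.rowStochastic ℝ S)
    (hP : IsIrreducible P) {A : Finset S} (hA : A.Nonempty) :
    IsUnit (1 - P.submatrix (↑) (↑) : Matrix ↥(Aᶜ) ↥(Aᶜ) ℝ) := by
  rw [← Matrix.mulVec_injective_iff_isUnit]
  refine (injective_iff_map_eq_zero (Matrix.mulVecLin
    (1 - P.submatrix (↑) (↑) : Matrix ↥(Aᶜ) ↥(Aᶜ) ℝ))).mpr fun v hv => ?_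
  rw [Matrix.mulVecLin_apply, Matrix.sub_mulVec, Matrix.one_mulVec, sub_eq_zero] at hv
  -- `w` is the extension of `|v|` by zero; it is subharmonic off `A`.
  let w : S → ℝ := fun s => if h : s ∈ Aᶜ then |v ⟨s, h⟩| else 0
  have hw0 : ∀ s, 0 ≤ w s := fun s => by
    simp only [w]; split_ifs <;> simp
  have hwA : ∀ s ∈ A, w s = 0 := fun s hs => by simp [w, hs]
  have hsub : ∀ s, s ∉ A → w s ≤ ∑ t, P s t * w t := fun s hs => by
    have hs' : s ∈ Aᶜ := by simpa using hs
    have hsplit : ∑ t, P s t * w t = ∑ t : ↥(Aᶜ), P s t * |v t| := by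
      rw [← Finset.sum_add_sum_compl A,
        Finset.sum_eq_zero fun t ht => by rw [hwA t ht, mul_zero], zero_add,
        ← Finset.sum_coe_sort]
      refine Finset.sum_congr rfl fun t _ => ?_
      simp only [w, t.2, dif_pos]
    rw [hsplit]
    simp only [w, hs', dif_pos]
    conv_lhs => rw [hv]
    refine (Finset.abs_sum_le_sum_abs _ _).trans_eq (Finset.sum_congr rfl fun t _ => ?_)
    rw [abs_mul]
    exact congrArg (· * |v t|) (abs_of_nonneg (Matrix.nonneg_of_mem_rowStochastic hst))
  obtain ⟨a, ha⟩ := hA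
  obtain ⟨m, -, hm⟩ := Finset.exists_max_image Finset.univ w ⟨a, Finset.mem_univ a⟩
  have hzero : w m = 0 := by
    by_contra hne
    have hpos : 0 < w m := lt_of_le_of_ne (hw0 m) (Ne.symm hne)
    refine hP (Finset.univ.filter fun s => w s = w m) ⟨m, by simp⟩ (fun h => ?_) ?_
    · have : w a = w m := by simpa using h.ge (Finset.mem_univ a)
      rw [hwA a ha] at this
      exact hne this.symm
    · intro s hs t ht
      have hs' : w s = w m := by simpa using hs
      have ht' : w t < w m := lt_of_le_of_ne (hm t (Finset.mem_univ t)) (by simpa using ht)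
      have hsA : s ∉ A := fun h => hne (by rw [← hs', hwA s h])
      by_contra hst0
      have hlt : ∑ r, P s r * w r < ∑ r, P s r * w m := by
        refine Finset.sum_lt_sum (fun r _ => mul_le_mul_of_nonneg_left (hm r (Finset.mem_univ r))
          (Matrix.nonneg_of_mem_rowStochastic hst)) ⟨t, Finset.mem_univ t, ?_⟩
        exact mul_lt_mul_of_pos_left ht'
          (lt_of_le_of_ne (Matrix.nonneg_of_mem_rowStochastic hst) (Ne.symm hst0))
      rw [← Finset.sum_mul, Matrix.sum_row_of_mem_rowStochastic hst, one_mul] at hlt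
      linarith [hsub s hsA]
  ext s
  have h := hm s (Finset.mem_univ _)
  rw [hzero] at h
  have hws : w s = |v s| := by simp only [w, s.2, dif_pos]
  rw [hws] at h
  exact abs_nonpos_iff.mp h

/-- The probability that the chain started at `s` is at `j` when it first is in `A`, time zero
included. -/
noncomputable def hitProb (P : Matrix S S ℝ) (A : Finset S) (j : A) (s : S) : ℝ :=
  if h : s ∈ Aᶜ then
    ((1 - P.submatrix (↑) (↑) : Matrix ↥(Aᶜ) ↥(Aᶜ) ℝ)⁻¹ *
      (P.submatrix (↑) (↑) : Matrix ↥(Aᶜ) A ℝ)) ⟨s, h⟩ j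
  else if s = j then 1 else 0

/-- The probability that the chain started at `s` is at `j` when it first is in `A` at a positive
time. -/
noncomputable def returnProb (P : Matrix S S ℝ) (A : Finset S) (j : A) (s : S) : ℝ :=
  ∑ t, P s t * hitProb P A j t

lemma hitProb_of_mem (P : Matrix S S ℝ) {A : Finset S} (j : A) {s : S} (hs : s ∈ A) :
    hitProb P A j s = if s = j then 1 else 0 := by
  simp [hitProb, hs]

lemma returnProb_eq (P : Matrix S S ℝ) {A : Finset S} (j : A) (s : S) :
    returnProb P A j s = P s j + ∑ t : ↥(Aᶜ), P s t *
      ((1 - P.submatrix (↑) (↑) : Matrix ↥(Aᶜ) ↥(Aᶜ) ℝ)⁻¹ *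
      (P.submatrix (↑) (↑) : Matrix ↥(Aᶜ) A ℝ)) t j := by
  rw [returnProb, ← Finset.sum_add_sum_compl A]
  congr 1
  · rw [Finset.sum_eq_single_of_mem (j : S) j.2]
    · simp [hitProb_of_mem]
    · intro t ht hne
      simp [hitProb_of_mem P j ht, hne]
  · rw [← Finset.sum_coe_sort]
    refine Finset.sum_congr rfl fun t _ => ?_
    simp only [hitProb, t.2, dif_pos]

lemma returnProb_of_mem (P : Matrix S S ℝ) {A : Finset S} (i j : A) :
    returnProb P A j i = stochasticComplement P A i j := by
  rw [returnProb_eq, stochasticComplement, Matrix.mul_assoc, Matrix.add_apply, Matrix.mul_apply]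
  rfl

/-- First-step analysis off `A`. -/
lemma returnProb_of_notMem {P : Matrix S S ℝ} (hst : P ∈ Matrix.rowStochastic ℝ S)
    (hP : IsIrreducible P) {A : Finset S} (j : A) {s : S} (hs : s ∉ A) :
    returnProb P A j s = hitProb P A j s := by
  have hs' : s ∈ Aᶜ := by simpa using hs
  have hu := isUnit_one_sub_submatrix_compl hst hP ⟨j, j.2⟩
  rw [returnProb_eq]
  simp only [hitProb, hs', dif_pos]
  set R : Matrix ↥(Aᶜ) A ℝ := P.submatrix (↑) (↑) with hR
  set M : Matrix ↥(Aᶜ) ↥(Aᶜ) ℝ := P.submatrix (↑) (↑) with hM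
  have key : (1 - M) * ((1 - M)⁻¹ * R) = R :=
    Matrix.mul_nonsing_inv_cancel_left _ _ ((Matrix.isUnit_iff_isUnit_det _).mp hu)
  rw [Matrix.sub_mul, Matrix.one_mul, sub_eq_iff_eq_add] at key
  have := congrFun (congrFun key ⟨s, hs'⟩) j
  rw [this, Matrix.add_apply, Matrix.mul_apply]
  rfl

end Irreducible

/-! ### Path weights and the law of a block -/

section Chain

variable {S : Type*}

lemma ofFn_snoc {n : ℕ} (x : Fin n → S) (b : S) :
    List.ofFn (Fin.snoc x b : Fin (n + 1) → S) = List.ofFn x ++ [b] := by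
  rw [List.ofFn_succ_last]
  simp

lemma sum_snoc [Fintype S] {n : ℕ} (F : (Fin (n + 1) → S) → ℝ) :
    ∑ x, F x = ∑ x : Fin n → S, ∑ b, F (Fin.snoc x b) := by
  rw [← (Fin.snocEquiv fun _ => S).sum_comp, Fintype.sum_prod_type_right]
  rfl

variable [DecidableEq S]

/-- The product of the transition probabilities along the path `l`. -/
noncomputable def pathWeight [Fintype S] (P : Matrix S S ℝ) (l : List S) : ℝ :=
  ∏ i, ∏ j, P i j ^ pairCount l i j

lemma pathWeight_append_pair [Fintype S] (P : Matrix S S ℝ) (l : List S) (a b : S) :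
    pathWeight P (l ++ [a] ++ [b]) = pathWeight P (l ++ [a]) * P a b := by
  simp only [pathWeight, pairCount_append_pair, pow_add, Finset.prod_mul_distrib]
  congr 1
  rw [Finset.prod_eq_single a, Finset.prod_eq_single b] <;> simp +contextual [eq_comm]

lemma pathWeight_ofFn_snoc [Fintype S] (P : Matrix S S ℝ) {m : ℕ} (x : Fin (m + 1) → S) (b : S) :
    pathWeight P (List.ofFn (Fin.snoc x b : Fin (m + 2) → S)) =
      pathWeight P (List.ofFn x) * P (x (Fin.last m)) b := by
  rw [ofFn_snoc, List.ofFn_succ_last, pathWeight_append_pair]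

lemma pathWeight_singleton [Fintype S] (P : Matrix S S ℝ) (a : S) : pathWeight P [a] = 1 := by
  simp [pathWeight, pairCount]

lemma sum_pathWeight [Fintype S] {P : Matrix S S ℝ} (hst : P ∈ Matrix.rowStochastic ℝ S) (m : ℕ) :
    ∑ x : Fin (m + 1) → S, pathWeight P (List.ofFn x) = Fintype.card S := by
  induction m with
  | zero => simp [pathWeight_singleton]
  | succ m ih =>
    rw [sum_snoc, ← ih]
    refine Finset.sum_congr rfl fun x _ => ?_
    simp only [pathWeight_ofFn_snoc, ← Finset.mul_sum]
    rw [Matrix.sum_row_of_mem_rowStochastic hst, mul_one]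

omit [DecidableEq S] in
lemma block_eq_snoc_iff {Ω : Type*} (X : ℤ → Ω → S) {n : ℕ} (x : Fin n → S) (b : S) (ω : Ω) :
    block X (n + 1) ω = Fin.snoc x b ↔ block X n ω = x ∧ X ((n : ℤ) + 1) ω = b := by
  rw [← Fin.snoc_init_self (block X (n + 1) ω), Fin.snoc_inj]
  rfl

lemma measureReal_cond {Ω : Type*} [MeasurableSpace Ω] {μ : Measure Ω} {s : Set Ω}
    (hs : MeasurableSet s) (t : Set Ω) :
    (μ[|s]).real t = (μ.real s)⁻¹ * μ.real (s ∩ t) := by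
  simp [Measure.real, cond_apply hs, ENNReal.toReal_mul, ENNReal.toReal_inv]

omit [DecidableEq S] in
lemma measureReal_block_mem_le {Ω : Type*} [MeasurableSpace Ω] [Fintype S] (μ : Measure Ω)
    [IsProbabilityMeasure μ] (X : ℤ → Ω → S) {n : ℕ} (T : Set (Fin n → S)) (f : (Fin n → S) → ℝ)
    (hf0 : ∀ x, 0 ≤ f x) (hf : ∀ x ∈ T, 1 ≤ f x) :
    μ.real {ω | block X n ω ∈ T} ≤ ∑ x : Fin n → S, μ.real {ω | block X n ω = x} * f x := by
  classical
  have hset : {ω | block X n ω ∈ T} ⊆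
      ⋃ x ∈ (Finset.univ.filter (· ∈ T) : Finset (Fin n → S)), {ω | block X n ω = x} := by
    intro ω hω
    simpa using hω
  refine (measureReal_mono hset (measure_ne_top _ _)).trans
    ((measureReal_biUnion_finset_le _ _).trans ?_)
  refine (Finset.sum_le_sum (g := fun x => μ.real {ω | block X n ω = x} * f x)
    fun x hx => ?_).trans (Finset.sum_le_sum_of_subset_of_nonneg (Finset.subset_univ _)
      fun x _ _ => mul_nonneg measureReal_nonneg (hf0 x))
  exact le_mul_of_one_le_right measureReal_nonneg (hf x (by simpa using hx))

section Law

variable {Ω : Type*} [MeasurableSpace Ω] [MeasurableSpace S] [Fintype S] {μ : Measure Ω}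
  {X : ℤ → Ω → S} {P : Matrix S S ℝ}

lemma IsMarkovChain.measurable_block (hX : IsMarkovChain μ X P) (n : ℕ) :
    Measurable (block X n) :=
  measurable_pi_lambda _ fun _ => hX.measurable _

lemma IsMarkovChain.measurableSet_block_eq [MeasurableSingletonClass S] (hX : IsMarkovChain μ X P)
    {n : ℕ} (x : Fin n → S) : MeasurableSet {ω | block X n ω = x} :=
  hX.measurable_block n (measurableSet_singleton x)

variable [IsProbabilityMeasure μ] [MeasurableSingletonClass S]

lemma IsMarkovChain.measureReal_block_snoc (hX : IsMarkovChain μ X P) {m : ℕ}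
    (x : Fin (m + 1) → S) (b : S) :
    μ.real {ω | block X (m + 2) ω = Fin.snoc x b} =
      μ.real {ω | block X (m + 1) ω = x} * P (x (Fin.last m)) b := by
  have hset : {ω | block X (m + 2) ω = Fin.snoc x b} =
      {ω | block X (m + 1) ω = x} ∩ {ω | X ((m : ℤ) + 2) ω = b} := by
    ext ω
    rw [Set.mem_ofPred_eq, block_eq_snoc_iff X x b ω]
    simp [add_assoc]
  by_cases h0 : μ {ω | block X (m + 1) ω = x} = 0
  · have h1 : μ.real {ω | block X (m + 1) ω = x} = 0 := by simp [Measure.real, h0]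
    rw [h1, zero_mul, hset]
    exact measureReal_mono_null Set.inter_subset_left h1
  · have hsub : {ω | block X (m + 1) ω = x} ⊆ {ω | X ((m : ℤ) + 1) ω = x (Fin.last m)} := by
      rintro ω rfl
      simp [block]
    have h1 : μ {ω | X ((m : ℤ) + 1) ω = x (Fin.last m)} ≠ 0 :=
      fun h => h0 (measure_mono_null hsub h)
    have h2 := (hX.markov m x b h0).trans (hX.transition m _ b h1)
    rw [measureReal_cond (hX.measurableSet_block_eq x)] at h2
    have h3 : μ.real {ω | block X (m + 1) ω = x} ≠ 0 := by
      simpa [Measure.real, ENNReal.toReal_eq_zero_iff] using h0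
    rw [hset, ← h2, mul_inv_cancel_left₀ h3]

lemma IsMarkovChain.measureReal_block_eq (hX : IsMarkovChain μ X P) {m : ℕ}
    (x : Fin (m + 1) → S) :
    μ.real {ω | block X (m + 1) ω = x} =
      μ.real {ω | X 1 ω = x 0} * pathWeight P (List.ofFn x) := by
  induction m with
  | zero =>
    have hset : {ω | block X 1 ω = x} = {ω | X 1 ω = x 0} := by
      ext ω
      simp [funext_iff, block]
    change μ.real {ω | block X 1 ω = x} = _
    rw [hset]
    simp [pathWeight_singleton]
  | succ m ih =>
    rw [← Fin.snoc_init_self x, hX.measureReal_block_snoc, ih, pathWeight_ofFn_snoc, mul_assoc]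
    congr 1

lemma IsMarkovChain.sum_measureReal_block (hX : IsMarkovChain μ X P) (n : ℕ) :
    ∑ x : Fin n → S, μ.real {ω | block X n ω = x} = 1 := by
  have h := sum_measureReal_preimage_singleton (μ := μ) (Finset.univ : Finset (Fin n → S))
    (f := block X n) fun x _ => hX.measurableSet_block_eq x
  simpa [Set.preimage] using h

/-! ### A weak law of large numbers for watched chains -/

/-- Chebyshev's inequality for a martingale with bounded increments, where `G` is the martingale
as a function of the path and `c` the predictable factor of its increments. -/
lemma IsMarkovChain.sum_sq_le (hX : IsMarkovChain μ X P) (h : S → ℝ) (G c : List S → ℝ)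
    (hc : ∀ l, c l ^ 2 ≤ 1) (hG0 : ∀ a, G [a] = 0)
    (hG : ∀ l a b, G (l ++ [a] ++ [b]) =
      G (l ++ [a]) + c (l ++ [a]) * (h b - ∑ t, P a t * h t)) (m : ℕ) :
    ∑ x : Fin (m + 1) → S, μ.real {ω | block X (m + 1) ω = x} * G (List.ofFn x) ^ 2 ≤
      m * ∑ a, ∑ b, P a b * (h b - ∑ t, P a t * h t) ^ 2 := by
  set C := ∑ a, ∑ b, P a b * (h b - ∑ t, P a t * h t) ^ 2 with hC
  have hP0 : ∀ {a b}, 0 ≤ P a b := Matrix.nonneg_of_mem_rowStochastic hX.stochastic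
  have hP1 : ∀ a, ∑ b, P a b = 1 := Matrix.sum_row_of_mem_rowStochastic hX.stochastic
  have hvar : ∀ a, ∑ b, P a b * (h b - ∑ t, P a t * h t) ^ 2 ≤ C := fun a =>
    Finset.single_le_sum (f := fun a => ∑ b, P a b * (h b - ∑ t, P a t * h t) ^ 2)
      (fun _ _ => Finset.sum_nonneg fun _ _ => mul_nonneg hP0 (sq_nonneg _)) (Finset.mem_univ a)
  have hC0 : 0 ≤ C :=
    Finset.sum_nonneg fun _ _ => Finset.sum_nonneg fun _ _ => mul_nonneg hP0 (sq_nonneg _)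
  induction m with
  | zero => simp [hG0]
  | succ m ih =>
    rw [sum_snoc]
    have hstep : ∀ x : Fin (m + 1) → S,
        ∑ b, μ.real {ω | block X (m + 2) ω = Fin.snoc x b} *
          G (List.ofFn (Fin.snoc x b : Fin (m + 2) → S)) ^ 2 ≤
        μ.real {ω | block X (m + 1) ω = x} * G (List.ofFn x) ^ 2 +
          μ.real {ω | block X (m + 1) ω = x} * C := fun x => by
      simp only [hX.measureReal_block_snoc, mul_assoc, ← Finset.mul_sum, ← mul_add]
      refine mul_le_mul_of_nonneg_left ?_ measureReal_nonneg
      simp only [ofFn_snoc]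
      rw [List.ofFn_succ_last]
      set a := x (Fin.last m)
      set l := List.ofFn fun i => x (Fin.castSucc i)
      set g := G (l ++ [a])
      set d := c (l ++ [a])
      -- The cross term vanishes because the increments are conditionally centred.
      have hcross : ∑ b, P a b * (h b - ∑ t, P a t * h t) = 0 := by
        simp only [mul_sub, Finset.sum_sub_distrib, ← Finset.sum_mul, hP1, one_mul, sub_self]
      calc ∑ b, P a b * G (l ++ [a] ++ [b]) ^ 2
          = ∑ b, (P a b * g ^ 2 + 2 * g * d * (P a b * (h b - ∑ t, P a t * h t)) +
              d ^ 2 * (P a b * (h b - ∑ t, P a t * h t) ^ 2)) := by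
            refine Finset.sum_congr rfl fun b _ => ?_
            rw [hG]
            ring
        _ = g ^ 2 + d ^ 2 * ∑ b, P a b * (h b - ∑ t, P a t * h t) ^ 2 := by
            rw [Finset.sum_add_distrib, Finset.sum_add_distrib, ← Finset.sum_mul,
              ← Finset.mul_sum, ← Finset.mul_sum, hcross, hP1]
            ring
        _ ≤ g ^ 2 + C := by
            have h1 := hvar a
            have h2 := hc (l ++ [a])
            have h3 : 0 ≤ ∑ b, P a b * (h b - ∑ t, P a t * h t) ^ 2 :=
              Finset.sum_nonneg fun _ _ => mul_nonneg hP0 (sq_nonneg _)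
            have := mul_le_mul_of_nonneg_right h2 h3
            linarith
    refine (Finset.sum_le_sum fun x _ => hstep x).trans ?_
    rw [Finset.sum_add_distrib, ← Finset.sum_mul, hX.sum_measureReal_block, one_mul]
    push_cast
    linarith

end Law

variable [Fintype S] {P : Matrix S S ℝ}

/-- The number of transitions from `i` to `j` of the chain watched on `A`, centred given the
number of departures from `i`, plus what the excursion from `i` in progress is expected to
contribute. As a function of the path, it is a martingale. The value `0` at the end of an empty path
is immaterial, as an empty path has no visits to `A`. -/
noncomputable def compensatedCount (P : Matrix S S ℝ) {A : Finset S} (i j : A) (l : List S) : ℝ :=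
  pairCount (subsequence A l) i j - stochasticComplement P A i j * stateCount (subsequence A l) i +
    if (subsequence A l).getLast? = some i then
      l.getLast?.elim 0 (returnProb P A j) - stochasticComplement P A i j else 0

lemma compensatedCount_singleton (P : Matrix S S ℝ) {A : Finset S} (i j : A) (a : S) :
    compensatedCount P i j [a] = 0 := by
  by_cases ha : a ∈ A
  · by_cases hai : (⟨a, ha⟩ : A) = i
    · subst hai
      simp [compensatedCount, subsequence, ha, pairCount, stateCount, ← returnProb_of_mem]
    · simp [compensatedCount, subsequence, ha, pairCount, stateCount, hai]
  · simp [compensatedCount, subsequence, ha, pairCount, stateCount]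

lemma compensatedCount_append_pair (hst : P ∈ Matrix.rowStochastic ℝ S) (hP : IsIrreducible P)
    {A : Finset S} (i j : A) (l : List S) (a b : S) :
    compensatedCount P i j (l ++ [a] ++ [b]) = compensatedCount P i j (l ++ [a]) +
      (if (subsequence A (l ++ [a])).getLast? = some i then 1 else 0) *
        (hitProb P A j b - ∑ t, P a t * hitProb P A j t) := by
  change _ = _ + _ * (_ - returnProb P A j a)
  by_cases hb : b ∈ A
  · rw [compensatedCount, compensatedCount, subsequence_append_of_mem _ hb, hitProb_of_mem _ _ hb]
    have hbj : ((b : S) = j) ↔ (⟨b, hb⟩ : A) = j := by rw [Subtype.ext_iff]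
    -- A completed excursion leaves no boundary term.
    have hbd : (if some (⟨b, hb⟩ : A) = some i then
        returnProb P A j b - stochasticComplement P A i j else 0) = 0 := by
      split_ifs with h
      · rw [← Option.some.inj h, ← returnProb_of_mem, sub_self]
      · rfl
    simp only [List.getLast?_append, List.getLast?_singleton, Option.some_or, Option.elim_some, hbd]
    rcases List.eq_nil_or_concat (subsequence A (l ++ [a])) with h | ⟨y, c, h⟩
    · simp [h, pairCount, stateCount]
    · rw [h, List.concat_eq_append, pairCount_append_pair, stateCount_append_singleton,
        stateCount_append_singleton]
      by_cases hc : c = i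
      · subst hc
        by_cases hj : b = j
        · simp [hj]; ring
        · simp [mt hbj.mpr hj, hj]; ring
      · simp [hc]
  · rw [compensatedCount, compensatedCount, subsequence_append_of_notMem _ hb,
      ← returnProb_of_notMem hst hP j hb]
    by_cases h : (subsequence A (l ++ [a])).getLast? = some i
    · simp [h]; ring
    · simp [h]

end Chain

/-! ### Typical sequences and entropy -/

section Entropy

variable {S : Type*} [DecidableEq S] [Fintype S]

lemma abs_sub_lt_of_isStronglyTypical {P : Matrix S S ℝ} {π : S → ℝ} {ε : ℝ} {l : List S}
    (h : IsStronglyTypical P π ε l) :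
    (∀ i j, |(pairCount l i j : ℝ) / stateCount l i - P i j| < ε) ∧
      ∀ i, |(stateCount l i : ℝ) / l.length - π i| < ε := by
  rcases h.2 with h | ⟨h1, h2⟩
  · exact h
  · refine ⟨fun i j => lt_of_le_of_lt ?_ h1, fun i => lt_of_le_of_lt ?_ h2⟩
    · exact (Finset.single_le_sum
        (f := fun j => |(pairCount l i j : ℝ) / stateCount l i - P i j|)
        (fun _ _ => abs_nonneg _) (Finset.mem_univ j)).trans
        (Finset.single_le_sum
          (f := fun i => ∑ j, |(pairCount l i j : ℝ) / stateCount l i - P i j|)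
          (fun _ _ => Finset.sum_nonneg fun _ _ => abs_nonneg _) (Finset.mem_univ i))
    · exact Finset.single_le_sum (f := fun i => |(stateCount l i : ℝ) / l.length - π i|)
        (fun _ _ => abs_nonneg _) (Finset.mem_univ i)

/-- Typicality of `x` itself, obtained from that of `x_A` for the whole space `A`, in terms of
absolute counts. -/
lemma abs_pairCount_sub_le {P : Matrix S S ℝ} (hst : P ∈ Matrix.rowStochastic ℝ S) {π : S → ℝ}
    (hπ : IsInvariant P π) {ε : ℝ} {l : List S}
    (h : IsStronglyTypical (stochasticComplement P Finset.univ)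
      (restrictedDistribution π Finset.univ) ε (subsequence Finset.univ l)) (i j : S) :
    |(pairCount l i j : ℝ) - l.length * (π i * P i j)| ≤ 2 * ε * l.length := by
  have hlen : (subsequence Finset.univ l).length = l.length := by
    rw [← List.length_map (f := Subtype.val), map_val_subsequence]
    simp
  have h1 := (abs_sub_lt_of_isStronglyTypical h).1 ⟨i, Finset.mem_univ i⟩ ⟨j, Finset.mem_univ j⟩
  have h2 := (abs_sub_lt_of_isStronglyTypical h).2 ⟨i, Finset.mem_univ i⟩
  have hn : 0 < (l.length : ℝ) := by
    have := h.1
    rw [hlen] at this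
    exact_mod_cast (by omega : 0 < l.length)
  rw [pairCount_subsequence_univ, stateCount_subsequence_univ, stochasticComplement_univ] at h1
  simp only [stateCount_subsequence_univ, hlen, restrictedDistribution, hπ.1.2, div_one] at h2
  have hε : 0 < ε := (abs_nonneg _).trans_lt h1
  have hP0 : 0 ≤ P i j := Matrix.nonneg_of_mem_rowStochastic hst
  have hP1 : P i j ≤ 1 := Matrix.le_one_of_mem_rowStochastic hst
  have hs0 : (0 : ℝ) ≤ stateCount l i := Nat.cast_nonneg _
  have hsn : (stateCount l i : ℝ) ≤ l.length := by exact_mod_cast stateCount_le_length l i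
  have h3 : |(pairCount l i j : ℝ) - stateCount l i * P i j| ≤ ε * l.length := by
    rcases hs0.eq_or_lt with h0 | h0
    · have : pairCount l i j = 0 := by
        have := pairCount_le_stateCount l i j
        have h0' : stateCount l i = 0 := by exact_mod_cast h0.symm
        omega
      rw [← h0, this]
      simpa using mul_nonneg hε.le hn.le
    · calc |(pairCount l i j : ℝ) - stateCount l i * P i j|
          = |(pairCount l i j : ℝ) / stateCount l i - P i j| * stateCount l i := by
            rw [← abs_of_pos h0, ← abs_mul, abs_of_pos h0]
            congr 1
            field_simp
        _ ≤ ε * l.length := mul_le_mul h1.le hsn hs0 hε.le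
  have h4 : |(stateCount l i : ℝ) - l.length * π i| ≤ ε * l.length := by
    calc |(stateCount l i : ℝ) - l.length * π i|
        = |(stateCount l i : ℝ) / l.length - π i| * l.length := by
          rw [← abs_of_pos hn, ← abs_mul, abs_of_pos hn]
          congr 1
          field_simp
      _ ≤ ε * l.length := mul_le_mul_of_nonneg_right h2.le hn.le
  calc |(pairCount l i j : ℝ) - l.length * (π i * P i j)|
      = |((pairCount l i j : ℝ) - stateCount l i * P i j) +
          ((stateCount l i : ℝ) - l.length * π i) * P i j| := by congr 1; ring
    _ ≤ |(pairCount l i j : ℝ) - stateCount l i * P i j| +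
          |(stateCount l i : ℝ) - l.length * π i| * P i j := by
        refine (abs_add_le _ _).trans_eq ?_
        rw [abs_mul, abs_of_nonneg hP0]
    _ ≤ ε * l.length + ε * l.length * 1 :=
        add_le_add h3 (mul_le_mul h4 hP1 hP0 (mul_nonneg hε.le hn.le))
    _ = 2 * ε * l.length := by ring

lemma abs_sum_pairCount_mul_sub_le {P : Matrix S S ℝ} {π : S → ℝ} {δ : ℝ} {l : List S}
    (h : ∀ i j, |(pairCount l i j : ℝ) - l.length * (π i * P i j)| ≤ δ) (f : S → S → ℝ) :
    |∑ i, ∑ j, (pairCount l i j : ℝ) * f i j - l.length * ∑ i, ∑ j, π i * P i j * f i j| ≤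
      δ * ∑ i, ∑ j, |f i j| := by
  simp only [Finset.mul_sum, ← Finset.sum_sub_distrib]
  refine (Finset.abs_sum_le_sum_abs _ _).trans (Finset.sum_le_sum fun i _ => ?_)
  refine (Finset.abs_sum_le_sum_abs _ _).trans (Finset.sum_le_sum fun j _ => ?_)
  rw [← mul_assoc, ← sub_mul, abs_mul]
  exact mul_le_mul_of_nonneg_right (h i j) (abs_nonneg _)

lemma logb_pathWeight {P : Matrix S S ℝ} {l : List S} (h : pathWeight P l ≠ 0) :
    Real.logb 2 (pathWeight P l) = ∑ i, ∑ j, (pairCount l i j : ℝ) * Real.logb 2 (P i j) := by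
  have h1 : ∀ i j, P i j ^ pairCount l i j ≠ 0 := fun i j =>
    Finset.prod_ne_zero_iff.mp (Finset.prod_ne_zero_iff.mp h i (Finset.mem_univ i)) j
      (Finset.mem_univ j)
  rw [pathWeight, Real.logb_prod _ _ fun i _ => Finset.prod_ne_zero_iff.mpr fun j _ => h1 i j]
  refine Finset.sum_congr rfl fun i _ => ?_
  rw [Real.logb_prod _ _ fun j _ => h1 i j]
  exact Finset.sum_congr rfl fun j _ => Real.logb_pow _ _ _

lemma two_rpow_lt_iff {a b : ℝ} (hb : 0 < b) : (2 : ℝ) ^ a < b ↔ a < Real.logb 2 b :=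
  (Real.lt_logb_iff_rpow_lt one_lt_two hb).symm

lemma lt_two_rpow_iff {a b : ℝ} (hb : 0 < b) : b < (2 : ℝ) ^ a ↔ Real.logb 2 b < a :=
  (Real.logb_lt_iff_lt_rpow one_lt_two hb).symm

/-- If every entry of the stochastic matrix `Q` is positive, then the number of sequences whose
transition counts are close to `n π_i p_{i,j}` is at most exponential in the cross entropy of `P`
with respect to `Q`, because the `Q`-weights of all sequences add up to `|S|`. -/
lemma card_mul_two_rpow_le {P Q : Matrix S S ℝ} {π : S → ℝ} (hQ : Q ∈ Matrix.rowStochastic ℝ S)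
    (hQ0 : ∀ i j, 0 < Q i j) {δ : ℝ} (m : ℕ) (T : Set (Fin (m + 1) → S))
    (hT : ∀ x ∈ T, ∀ i j,
      |(pairCount (List.ofFn x) i j : ℝ) - ((m + 1 : ℕ) : ℝ) * (π i * P i j)| ≤ δ) :
    (T.ncard : ℝ) * (2 : ℝ) ^ (((m + 1 : ℕ) : ℝ) * (∑ i, ∑ j, π i * P i j * Real.logb 2 (Q i j)) -
      δ * ∑ i, ∑ j, |Real.logb 2 (Q i j)|) ≤ Fintype.card S := by
  classical
  have hw : ∀ l, 0 < pathWeight Q l := fun l =>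
    Finset.prod_pos fun i _ => Finset.prod_pos fun j _ => pow_pos (hQ0 i j) _
  rw [Set.ncard_eq_toFinset_card', ← nsmul_eq_mul, ← sum_pathWeight hQ m]
  refine le_trans (Finset.card_nsmul_le_sum T.toFinset
    (fun x => pathWeight Q (List.ofFn x)) _ fun x hx => ?_)
    (Finset.sum_le_sum_of_subset_of_nonneg (Finset.subset_univ _) fun x _ _ => (hw _).le)
  rw [← Real.le_logb_iff_rpow_le one_lt_two (hw _), logb_pathWeight (hw _).ne']
  have h := abs_sum_pairCount_mul_sub_le (l := List.ofFn x) (P := P) (π := π) (δ := δ)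
    (by simpa using hT x (by simpa using hx)) fun i j => Real.logb 2 (Q i j)
  rw [List.length_ofFn] at h
  linarith [(abs_le.mp h).1]

/-- Every stochastic matrix is close, in cross entropy, to a positive stochastic matrix, namely to
its mixture with the uniform matrix. -/
lemma exists_pos_stochastic {P : Matrix S S ℝ} (hst : P ∈ Matrix.rowStochastic ℝ S) {π : S → ℝ}
    (hπ : π ∈ stdSimplex ℝ S) {η : ℝ} (hη : 0 < η) :
    ∃ Q ∈ Matrix.rowStochastic ℝ S, (∀ i j, 0 < Q i j) ∧
      -condEntropy P π - η ≤ ∑ i, ∑ j, π i * P i j * Real.logb 2 (Q i j) := by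
  have hP0 : ∀ {a b}, 0 ≤ P a b := Matrix.nonneg_of_mem_rowStochastic hst
  have hP1 : ∀ a, ∑ b, P a b = 1 := Matrix.sum_row_of_mem_rowStochastic hst
  -- With this weight on `P`, each logarithm drops by at most `η`.
  set c : ℝ := 2 ^ (-η) with hc
  have hc0 : 0 < c := by positivity
  have hc1 : c < 1 := Real.rpow_lt_one_of_one_lt_of_neg one_lt_two (by linarith)
  have hQP : ∀ i j, c * P i j ≤ c * P i j + (1 - c) / Fintype.card S := fun i j =>
    le_add_of_nonneg_right (div_nonneg (by linarith) (Nat.cast_nonneg _))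
  have hQ0 : ∀ i j : S, 0 < c * P i j + (1 - c) / Fintype.card S := fun i j => by
    have : (0 : ℝ) < Fintype.card S := by exact_mod_cast Fintype.card_pos_iff.mpr ⟨i⟩
    exact add_pos_of_nonneg_of_pos (mul_nonneg hc0.le hP0) (div_pos (by linarith) this)
  refine ⟨Matrix.of fun i j => c * P i j + (1 - c) / Fintype.card S, ?_, hQ0, ?_⟩
  · refine Matrix.mem_rowStochastic_iff_sum.mpr ⟨fun i j => (hQ0 i j).le, fun i => ?_⟩
    have : (Fintype.card S : ℝ) ≠ 0 := by exact_mod_cast (Fintype.card_pos_iff.mpr ⟨i⟩).ne'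
    simp only [Matrix.of_apply, Finset.sum_add_distrib, ← Finset.mul_sum, hP1, Finset.sum_const,
      Finset.card_univ, nsmul_eq_mul]
    field_simp
    ring
  · have hsum : ∑ i, ∑ j, π i * P i j * η = η := by
      simp only [← Finset.sum_mul, ← Finset.mul_sum, hP1, mul_one, hπ.2, one_mul]
    rw [condEntropy, neg_neg]
    conv_lhs => rw [← hsum]
    simp only [← Finset.sum_sub_distrib]
    refine Finset.sum_le_sum fun i _ => Finset.sum_le_sum fun j _ => ?_
    rw [← mul_sub]
    rcases hP0.eq_or_lt (b := P i j) with h0 | h0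
    · simp [← h0]
    · refine mul_le_mul_of_nonneg_left ?_ (mul_nonneg (hπ.1 i) hP0)
      have h1 : Real.logb 2 (c * P i j) = Real.logb 2 (P i j) - η := by
        rw [Real.logb_mul hc0.ne' h0.ne', hc, Real.logb_rpow two_pos (by norm_num)]
        ring
      rw [← h1]
      exact Real.logb_le_logb_of_le one_lt_two (mul_pos hc0 h0) (hQP i j)

lemma ncard_supremusTypicalSet_lt [Nonempty S] {P Q : Matrix S S ℝ} {π : S → ℝ}
    (hst : P ∈ Matrix.rowStochastic ℝ S) (hπ : IsInvariant P π)
    (hQ : Q ∈ Matrix.rowStochastic ℝ S) (hQ0 : ∀ i j, 0 < Q i j) {ε η : ℝ}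
    (hPQ : -condEntropy P π - η / 4 ≤ ∑ i, ∑ j, π i * P i j * Real.logb 2 (Q i j))
    (hε : 2 * ε * ∑ i, ∑ j, |Real.logb 2 (Q i j)| ≤ η / 2) {n : ℕ}
    (hn : Real.logb 2 (Fintype.card S) < n * (η / 4)) :
    ((supremusTypicalSet P π ε n).ncard : ℝ) < (2 : ℝ) ^ ((n : ℝ) * (condEntropy P π + η)) := by
  have hS : (0 : ℝ) < Fintype.card S := by exact_mod_cast Fintype.card_pos
  obtain _ | m := n
  · have := Real.logb_nonneg one_lt_two (x := (Fintype.card S : ℝ))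
      (by exact_mod_cast Fintype.card_pos)
    simp only [Nat.cast_zero, zero_mul] at hn
    linarith
  have h := card_mul_two_rpow_le (P := P) (π := π) hQ hQ0 (δ := 2 * ε * (m + 1 : ℕ)) m
    (supremusTypicalSet P π ε (m + 1)) fun x hx i j => by
      simpa using abs_pairCount_sub_le hst hπ (hx.2 _ Finset.univ_nonempty) i j
  set n : ℝ := ((m + 1 : ℕ) : ℝ)
  have hn0 : 0 ≤ n := Nat.cast_nonneg _
  set E := n * (∑ i, ∑ j, π i * P i j * Real.logb 2 (Q i j)) -
    2 * ε * n * ∑ i, ∑ j, |Real.logb 2 (Q i j)| with hE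
  have hE' : -(n * (condEntropy P π + 3 * η / 4)) ≤ E := by
    have h1 := mul_le_mul_of_nonneg_left hPQ hn0
    have h2 := mul_le_mul_of_nonneg_left hε hn0
    rw [hE]
    linarith
  have hcard : (Fintype.card S : ℝ) < 2 ^ (n * (η / 4)) := (lt_two_rpow_iff hS).mpr hn
  have h2E : (0 : ℝ) < 2 ^ E := by positivity
  rw [← le_div_iff₀ h2E, div_eq_mul_inv, ← Real.rpow_neg two_pos.le] at h
  refine h.trans_lt ?_
  calc (Fintype.card S : ℝ) * 2 ^ (-E)
      < 2 ^ (n * (η / 4)) * 2 ^ (-E) := mul_lt_mul_of_pos_right hcard (by positivity)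
    _ = 2 ^ (n * (η / 4) - E) := by rw [← Real.rpow_add two_pos, sub_eq_add_neg]
    _ ≤ 2 ^ (n * (condEntropy P π + η)) :=
        Real.rpow_le_rpow_of_exponent_le one_le_two (by linarith)

lemma IsMarkovChain.measureReal_block_bounds {Ω : Type*} [MeasurableSpace Ω] [MeasurableSpace S]
    [MeasurableSingletonClass S] {μ : Measure Ω} [IsProbabilityMeasure μ] {X : ℤ → Ω → S}
    {P : Matrix S S ℝ} {π : S → ℝ} (hX : IsMarkovChain μ X P) (hπ : IsInvariant P π) {ε η : ℝ}
    (hε : 2 * ε * ∑ i, ∑ j, |Real.logb 2 (P i j)| ≤ η / 2) {n : ℕ} (hn0 : 0 < n)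
    (hn : ∑ a, |Real.logb 2 (μ.real {ω | X 1 ω = a})| < n * (η / 2)) {x : Fin n → S}
    (hx : x ∈ supremusTypicalSet P π ε n) :
    (0 < μ.real {ω | block X n ω = x} →
      (2 : ℝ) ^ (-(n : ℝ) * (condEntropy P π + η)) < μ.real {ω | block X n ω = x}) ∧
      μ.real {ω | block X n ω = x} < (2 : ℝ) ^ (-(n : ℝ) * (condEntropy P π - η)) := by
  obtain _ | m := n
  · exact absurd hn0 (lt_irrefl 0)
  rcases (measureReal_nonneg (μ := μ) (s := {ω | block X (m + 1) ω = x})).eq_or_lt with h0 | h0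
  · rw [← h0]
    exact ⟨fun h => absurd h (lt_irrefl 0), by positivity⟩
  rw [two_rpow_lt_iff h0, lt_two_rpow_iff h0]
  have hne := h0.ne'
  rw [hX.measureReal_block_eq] at hne ⊢
  have ha := left_ne_zero_of_mul hne
  have hw := right_ne_zero_of_mul hne
  rw [Real.logb_mul ha hw, logb_pathWeight hw]
  have h := abs_sum_pairCount_mul_sub_le (l := List.ofFn x) (P := P) (π := π)
    (δ := 2 * ε * (m + 1 : ℕ)) (fun i j => by
      simpa using abs_pairCount_sub_le hX.stochastic hπ (hx.2 _ ⟨x 0, Finset.mem_univ _⟩) i j)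
    fun i j => Real.logb 2 (P i j)
  rw [List.length_ofFn] at h
  have hH : ∑ i, ∑ j, π i * P i j * Real.logb 2 (P i j) = -condEntropy P π := by
    rw [condEntropy, neg_neg]
  rw [hH] at h
  have h1 : |Real.logb 2 (μ.real {ω | X 1 ω = x 0})| < (m + 1 : ℕ) * (η / 2) :=
    (Finset.single_le_sum (f := fun a => |Real.logb 2 (μ.real {ω | X 1 ω = a})|)
      (fun _ _ => abs_nonneg _) (Finset.mem_univ (x 0))).trans_lt hn
  have h2 := mul_le_mul_of_nonneg_left hε (Nat.cast_nonneg (α := ℝ) (m + 1))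
  obtain ⟨h3, h4⟩ := abs_le.mp h
  obtain ⟨h5, h6⟩ := abs_lt.mp h1
  constructor
  · intro _
    linarith
  · linarith

end Entropy

/-! ### Typicality with high probability -/

section Probability

open Filter Topology

variable {S : Type*} [DecidableEq S] [Fintype S]

/-- The property `T` of finite sequences holds for the block `[X⁽¹⁾, …, X⁽ⁿ⁾]` with probability
tending to one as `n → ∞`. -/
def HoldsWhp {Ω S : Type*} [MeasurableSpace Ω] (μ : Measure Ω) (X : ℤ → Ω → S)
    (T : List S → Prop) : Prop :=
  Tendsto (fun n => μ.real {ω | ¬ T (List.ofFn (block X n ω))}) atTop (𝓝 0)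

section Whp

variable {Ω : Type*} [MeasurableSpace Ω] {μ : Measure Ω} [IsProbabilityMeasure μ] {X : ℤ → Ω → S}

omit [DecidableEq S] [Fintype S] in
lemma HoldsWhp.mono {T T' : List S → Prop} (h : HoldsWhp μ X T) (N : ℝ)
    (hT : ∀ l : List S, N ≤ l.length → T l → T' l) : HoldsWhp μ X T' := by
  refine squeeze_zero' (Eventually.of_forall fun _ => measureReal_nonneg) ?_ h
  filter_upwards [eventually_ge_atTop ⌈N⌉₊] with n hn
  refine measureReal_mono (fun ω hω h => hω (hT _ ?_ h)) (measure_ne_top _ _)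
  rw [List.length_ofFn]
  exact Nat.ceil_le.mp hn

omit [DecidableEq S] [Fintype S] in
lemma HoldsWhp.forall {ι : Type*} [Fintype ι] {T : ι → List S → Prop}
    (h : ∀ i, HoldsWhp μ X (T i)) : HoldsWhp μ X fun l => ∀ i, T i l := by
  have hsum : Tendsto (fun n => ∑ i, μ.real {ω | ¬ T i (List.ofFn (block X n ω))}) atTop (𝓝 0) := by
    simpa using tendsto_finsetSum Finset.univ fun i _ => h i
  refine squeeze_zero (fun _ => measureReal_nonneg) (fun n => ?_) hsum
  refine (measureReal_mono (s₂ := ⋃ i ∈ Finset.univ, {ω | ¬ T i (List.ofFn (block X n ω))})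
    (fun ω hω => ?_) (measure_ne_top _ _)).trans (measureReal_biUnion_finset_le _ _)
  simpa using hω

omit [DecidableEq S] [Fintype S] in
lemma HoldsWhp.and {T T' : List S → Prop} (h : HoldsWhp μ X T) (h' : HoldsWhp μ X T') :
    HoldsWhp μ X fun l => T l ∧ T' l := by
  refine (HoldsWhp.forall (ι := Bool) (T := fun b => cond b T T') ?_).mono 0 fun l _ hl =>
    ⟨hl true, hl false⟩
  rintro (_ | _)
  · exact h'
  · exact h

variable [MeasurableSpace S] [MeasurableSingletonClass S] {P : Matrix S S ℝ}

/-- Chebyshev's inequality: the second moment is `O(n)`, the threshold squared is of order `n²`. -/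
lemma IsMarkovChain.whp_compensatedCount (hX : IsMarkovChain μ X P) (hP : IsIrreducible P)
    {A : Finset S} (i j : A) {δ : ℝ} (hδ : 0 < δ) :
    HoldsWhp μ X fun l => |compensatedCount P i j l| ≤ δ * l.length := by
  set C := ∑ a, ∑ b, P a b * (hitProb P A j b - ∑ t, P a t * hitProb P A j t) ^ 2 with hC
  have hC0 : 0 ≤ C := Finset.sum_nonneg fun _ _ => Finset.sum_nonneg fun _ _ =>
    mul_nonneg (Matrix.nonneg_of_mem_rowStochastic hX.stochastic) (sq_nonneg _)
  have hlim : Tendsto (fun n : ℕ => C / δ ^ 2 / n) atTop (𝓝 0) :=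
    tendsto_const_div_atTop_nhds_zero_nat _
  refine squeeze_zero' (Eventually.of_forall fun _ => measureReal_nonneg) ?_ hlim
  filter_upwards [eventually_ge_atTop 1] with n hn
  obtain ⟨m, rfl⟩ : ∃ m, n = m + 1 := ⟨n - 1, by omega⟩
  set n : ℝ := ((m + 1 : ℕ) : ℝ) with hn'
  have hn0 : 0 < n := by positivity
  have hmn : (m : ℝ) ≤ n := by rw [hn']; push_cast; linarith
  have hsq := hX.sum_sq_le (hitProb P A j) (compensatedCount P i j)
    (fun l => if (subsequence A l).getLast? = some i then 1 else 0)
    (fun l => by split_ifs <;> norm_num) (compensatedCount_singleton P i j)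
    (compensatedCount_append_pair hX.stochastic hP i j) m
  refine (measureReal_block_mem_le μ X
    {x : Fin (m + 1) → S | ¬ |compensatedCount P i j (List.ofFn x)| ≤ δ * (List.ofFn x).length}
    (fun x => ((δ * n) ^ 2)⁻¹ * compensatedCount P i j (List.ofFn x) ^ 2)
    (fun x => by positivity) fun x hx => ?_).trans ?_
  · have hx' : δ * n < |compensatedCount P i j (List.ofFn x)| := by simpa [hn'] using hx
    rw [inv_mul_eq_div, one_le_div (by positivity), ← sq_abs (compensatedCount P i j _)]
    exact pow_le_pow_left₀ (by positivity) hx'.le 2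
  · calc ∑ x : Fin (m + 1) → S, μ.real {ω | block X (m + 1) ω = x} *
          (((δ * n) ^ 2)⁻¹ * compensatedCount P i j (List.ofFn x) ^ 2)
        = ((δ * n) ^ 2)⁻¹ * ∑ x : Fin (m + 1) → S, μ.real {ω | block X (m + 1) ω = x} *
            compensatedCount P i j (List.ofFn x) ^ 2 := by
          rw [Finset.mul_sum]
          exact Finset.sum_congr rfl fun x _ => by ring
      _ ≤ ((δ * n) ^ 2)⁻¹ * (n * C) := by
          refine mul_le_mul_of_nonneg_left (hsq.trans ?_) (by positivity)
          exact mul_le_mul_of_nonneg_right hmn hC0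
      _ = C / δ ^ 2 / n := by field_simp

lemma IsMarkovChain.whp_pairCount_sub (hX : IsMarkovChain μ X P) (hP : IsIrreducible P)
    {A : Finset S} (i j : A) {δ : ℝ} (hδ : 0 < δ) :
    HoldsWhp μ X fun l => |(pairCount (subsequence A l) i j : ℝ) -
      stochasticComplement P A i j * stateCount (subsequence A l) i| ≤ δ * l.length := by
  set B := ∑ s, |returnProb P A j s| + |stochasticComplement P A i j| with hB
  refine (hX.whp_compensatedCount hP i j (half_pos hδ)).mono (B / (δ / 2)) fun l hl h => ?_
  rw [div_le_iff₀ (half_pos hδ)] at hl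
  have hbd : |if (subsequence A l).getLast? = some i then
      l.getLast?.elim 0 (returnProb P A j) - stochasticComplement P A i j else 0| ≤ B := by
    have h0 : 0 ≤ ∑ s, |returnProb P A j s| := Finset.sum_nonneg fun _ _ => abs_nonneg _
    split_ifs
    · refine (abs_sub _ _).trans (add_le_add_left ?_ _)
      cases l.getLast? with
      | none => simpa using h0
      | some a =>
        exact Finset.single_le_sum (f := fun s => |returnProb P A j s|)
          (fun _ _ => abs_nonneg _) (Finset.mem_univ a)
    · rw [abs_zero]
      positivity
  rw [compensatedCount] at h
  obtain ⟨h1, h2⟩ := abs_le.mp h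
  obtain ⟨h3, h4⟩ := abs_le.mp hbd
  rw [abs_le]
  constructor <;> linarith

/-- Law of large numbers for the visits to each state: the empirical distribution is almost
invariant, hence close to the invariant distribution. -/
lemma IsMarkovChain.whp_count_sub (hX : IsMarkovChain μ X P) (hP : IsIrreducible P)
    {π : S → ℝ} (hπ : IsInvariant P π) {δ : ℝ} (hδ : 0 < δ) :
    HoldsWhp μ X fun l => ∀ i, |(l.count i : ℝ) - l.length * π i| ≤ δ * l.length := by
  obtain ⟨K, hK0, hK⟩ := exists_abs_le_of_sum_eq_zero hX.stochastic hP
  set ρ := δ / (K * (Fintype.card S + 1)) with hρ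
  have hρ0 : 0 < ρ := by positivity
  have hρK : K * (ρ * (Fintype.card S + 1)) = δ := by rw [hρ]; field_simp
  have hall := HoldsWhp.forall fun q : S × S => hX.whp_pairCount_sub hP
    (⟨q.1, Finset.mem_univ q.1⟩ : (Finset.univ : Finset S)) ⟨q.2, Finset.mem_univ q.2⟩ hρ0
  refine hall.mono (1 + ρ⁻¹) fun l hl h => ?_
  have hlρ : 1 ≤ ρ * l.length := by
    have := mul_le_mul_of_nonneg_left hl hρ0.le
    rw [mul_add, mul_inv_cancel₀ hρ0.ne'] at this
    linarith
  have hl1 : (1 : ℝ) ≤ l.length := by linarith [inv_pos.mpr hρ0]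
  simp only [pairCount_subsequence_univ, stateCount_subsequence_univ,
    stochasticComplement_univ] at h
  have hP0 : ∀ {a b}, 0 ≤ P a b := Matrix.nonneg_of_mem_rowStochastic hX.stochastic
  have hP1 : ∀ {a b}, P a b ≤ 1 := Matrix.le_one_of_mem_rowStochastic hX.stochastic
  have hinv : ∀ j, ∑ i, π i * P i j = π j := fun j => congrFun hπ.2 j
  have hlen : ∑ i, (l.count i : ℝ) = l.length := by
    have := Multiset.sum_count_eq_card (s := Finset.univ) (m := (l : Multiset S))
      fun _ _ => Finset.mem_univ _
    simp only [Multiset.coe_count, Multiset.coe_card] at this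
    exact_mod_cast this
  intro i
  rw [← hρK, mul_assoc]
  refine hK (fun i => (l.count i : ℝ) - l.length * π i)
    (ρ * (Fintype.card S + 1) * l.length) (by positivity) ?_ (fun j => ?_) i
  · rw [Finset.sum_sub_distrib, ← Finset.mul_sum, hπ.1.2, hlen, mul_one, sub_self]
  -- Invariance of `π` reduces the defect to that of the counts themselves, which is the sum over
  -- `i` of the centred transition counts, up to the two end points of the path.
  have hred : (l.count j : ℝ) - l.length * π j -
      ∑ i, ((l.count i : ℝ) - l.length * π i) * P i j =
      l.count j - ∑ i, (l.count i : ℝ) * P i j := by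
    simp only [sub_mul, Finset.sum_sub_distrib, mul_assoc, ← Finset.mul_sum, hinv]
    ring
  have hcol : ∃ t : ℝ, 0 ≤ t ∧ t ≤ 1 ∧ (l.count j : ℝ) = ∑ i, (pairCount l i j : ℝ) + t := by
    cases l with
    | nil => norm_num at hl1
    | cons a l =>
      have hs : (∑ i, (pairCount (a :: l) i j : ℝ)) = l.count j := by
        exact_mod_cast sum_pairCount_cons a l j
      rw [hs, List.count_cons]
      refine ⟨if a == j then 1 else 0, ?_, ?_, ?_⟩ <;> split_ifs <;> simp
  have hrow : ∃ t : ℝ, 0 ≤ t ∧ t ≤ 1 ∧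
      ∑ i, (l.count i : ℝ) * P i j = ∑ i, P i j * (stateCount l i : ℝ) + t := by
    rcases List.eq_nil_or_concat l with rfl | ⟨l', a, rfl⟩
    · norm_num at hl1
    · refine ⟨P a j, hP0, hP1, ?_⟩
      simp only [List.concat_eq_append, stateCount_append_singleton, List.count_append]
      simp [mul_comm, mul_add, Finset.sum_add_distrib, List.count_singleton]
  obtain ⟨t, ht0, ht1, ht⟩ := hcol
  obtain ⟨s, hs0, hs1, hs⟩ := hrow
  rw [hred, ht, hs]
  have hsum : |∑ i, ((pairCount l i j : ℝ) - P i j * stateCount l i)| ≤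
      Fintype.card S * (ρ * l.length) := by
    refine (Finset.abs_sum_le_sum_abs _ _).trans ?_
    refine (Finset.sum_le_card_nsmul _ _ _ fun i _ => h (i, j)).trans_eq ?_
    rw [Finset.card_univ, nsmul_eq_mul]
  rw [Finset.sum_sub_distrib] at hsum
  obtain ⟨h1, h2⟩ := abs_le.mp hsum
  rw [abs_le]
  constructor <;> linarith

/-- Sequences whose counts are close to their expected values are typical for the chain watched
on `A`. -/
lemma IsMarkovChain.whp_isStronglyTypical (hX : IsMarkovChain μ X P) (hP : IsIrreducible P)
    {π : S → ℝ} (hπ : IsInvariant P π) {A : Finset S} (hA : A.Nonempty) {ε : ℝ} (hε : 0 < ε) :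
    HoldsWhp μ X fun l => IsStronglyTypical (stochasticComplement P A)
      (restrictedDistribution π A) ε (subsequence A l) := by
  obtain ⟨a, ha⟩ := hA
  have hpos := fun i => IsInvariant.pos hX.stochastic hP hπ i
  obtain ⟨k, -, hk⟩ := Finset.exists_min_image Finset.univ π ⟨a, Finset.mem_univ a⟩
  set p := π k with hp
  have hp0 : 0 < p := hpos k
  have hpπ : ∀ i, p ≤ π i := fun i => hk i (Finset.mem_univ i)
  have hπ1 : ∀ i, π i ≤ 1 := fun i =>
    (Finset.single_le_sum (f := π) (fun j _ => hπ.1.1 j) (Finset.mem_univ i)).trans_eq hπ.1.2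
  have hp1 : p ≤ 1 := hπ1 k
  set c : ℝ := (Fintype.card S : ℝ) with hc
  have hc0 : 0 ≤ c := Nat.cast_nonneg _
  -- The first bound keeps all state counts above `p n / 2`; the second makes the errors of both
  -- quotients less than `ε`.
  set δ := min (p / 4) (ε * p ^ 2 / (4 * (c + 2))) with hδ
  have hδ0 : 0 < δ := lt_min (by positivity) (by positivity)
  have hδp : δ ≤ p / 4 := min_le_left _ _
  have hδε : (c + 2) * δ < ε * (p * (p / 2)) := by
    have h1 : δ ≤ ε * p ^ 2 / (4 * (c + 2)) := min_le_right _ _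
    rw [le_div_iff₀ (by positivity)] at h1
    have h2 : 0 < ε * p ^ 2 := by positivity
    nlinarith
  have hδε' : δ < ε * (p / 2) := by
    have h1 : p * (p / 2) ≤ p / 2 := by nlinarith
    have h2 := mul_le_mul_of_nonneg_left h1 hε.le
    have h3 : δ ≤ (c + 2) * δ := le_mul_of_one_le_left hδ0.le (by linarith)
    linarith
  set q := ∑ j ∈ A, π j with hq
  have hpq : p ≤ q := (hpπ a).trans (Finset.single_le_sum (fun j _ => hπ.1.1 j) ha)
  have hq1 : q ≤ 1 := (Finset.sum_le_sum_of_subset_of_nonneg (Finset.subset_univ A)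
    fun j _ _ => hπ.1.1 j).trans_eq hπ.1.2
  have hall := (HoldsWhp.forall fun z : A × A => hX.whp_pairCount_sub hP z.1 z.2 hδ0).and
    (hX.whp_count_sub hP hπ hδ0)
  refine hall.mono (δ⁻¹ + 4 / p) fun l hl ⟨h1, h2⟩ => ?_
  set n : ℝ := (l.length : ℝ) with hn
  have hnδ : 1 ≤ δ * n := by
    have h3 := mul_le_mul_of_nonneg_left hl hδ0.le
    rw [mul_add, mul_inv_cancel₀ hδ0.ne'] at h3
    have : 0 < δ * (4 / p) := by positivity
    linarith
  have hnp : 4 ≤ p * n := by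
    have h3 := mul_le_mul_of_nonneg_left hl hp0.le
    rw [mul_add, mul_div_cancel₀ _ hp0.ne'] at h3
    have : 0 < p * δ⁻¹ := by positivity
    linarith
  have hn0 : 0 < n := by
    by_contra h
    nlinarith
  have hδn : δ * n ≤ p / 4 * n := mul_le_mul_of_nonneg_right hδp hn0.le
  have hcount : ∀ i, p * n * (3 / 4) ≤ (l.count i : ℝ) := fun i => by
    have h3 := (abs_le.mp (h2 i)).1
    have h4 : n * p ≤ n * π i := mul_le_mul_of_nonneg_left (hpπ i) hn0.le
    linarith
  have hlenA : ((subsequence A l).length : ℝ) = ∑ i ∈ A, (l.count i : ℝ) := by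
    rw [length_subsequence]
    push_cast
    rfl
  have hlen_ge : p * n * (3 / 4) ≤ ((subsequence A l).length : ℝ) := by
    rw [hlenA]
    exact (hcount a).trans
      (Finset.single_le_sum (f := fun i => (l.count i : ℝ)) (fun i _ => Nat.cast_nonneg _) ha)
  have hlen_sub : |((subsequence A l).length : ℝ) - n * q| ≤ c * (δ * n) := by
    rw [hlenA, hq, Finset.mul_sum, ← Finset.sum_sub_distrib]
    refine (Finset.abs_sum_le_sum_abs _ _).trans ?_
    refine (Finset.sum_le_card_nsmul _ _ _ fun i _ => h2 i).trans ?_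
    rw [nsmul_eq_mul]
    refine mul_le_mul_of_nonneg_right ?_ (by linarith)
    rw [hc]
    exact_mod_cast Finset.card_le_univ A
  -- `N(i; x_A)` does not count the last entry of `x_A`.
  have hstate : ∀ i : A, ∃ t : ℝ, 0 ≤ t ∧ t ≤ 1 ∧
      (l.count (i : S) : ℝ) = stateCount (subsequence A l) i + t := fun i => by
    refine ⟨if (subsequence A l).getLast? = some i then 1 else 0, ?_, ?_, ?_⟩
    · split_ifs <;> simp
    · split_ifs <;> simp
    · exact_mod_cast count_eq_stateCount_subsequence_add A l i
  have hstate_ge : ∀ i : A, p / 2 * n ≤ stateCount (subsequence A l) i := fun i => by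
    obtain ⟨t, ht0, ht1, ht⟩ := hstate i
    have := hcount i
    linarith
  have hpn : 0 < p / 2 * n := by positivity
  refine ⟨?_, Or.inl ⟨fun i j => ?_, fun i => ?_⟩⟩
  · have : (2 : ℝ) ≤ (subsequence A l).length := by linarith
    exact_mod_cast this
  · have hs := hstate_ge i
    have hs0 : (0 : ℝ) < stateCount (subsequence A l) i := hpn.trans_le hs
    rw [div_sub' hs0.ne', abs_div, abs_of_pos hs0, div_lt_iff₀ hs0, mul_comm (stateCount _ i : ℝ)]
    have h3 := mul_lt_mul_of_pos_right hδε' hn0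
    have h4 := mul_le_mul_of_nonneg_left hs hε.le
    have h5 := h1 (i, j)
    simp only at h5
    linarith
  · set b : ℝ := ((subsequence A l).length : ℝ) with hb
    set s : ℝ := (stateCount (subsequence A l) i : ℝ) with hs
    have hb0 : 0 < b := by linarith
    have hq0 : 0 < q := by linarith
    have hs_sub : |s - n * π i| ≤ 2 * (δ * n) := by
      obtain ⟨t, ht0, ht1, ht⟩ := hstate i
      obtain ⟨h3, h4⟩ := abs_le.mp (h2 i)
      rw [abs_le]
      constructor <;> linarith
    have hnum : |s * q - b * π i| ≤ (c + 2) * δ * n := by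
      calc |s * q - b * π i| = |(s - n * π i) * q - (b - n * q) * π i| := by congr 1; ring
        _ ≤ |s - n * π i| * q + |b - n * q| * π i := by
          refine (abs_sub _ _).trans_eq ?_
          rw [abs_mul, abs_mul, abs_of_pos hq0, abs_of_pos (hpos i)]
        _ ≤ 2 * (δ * n) * 1 + c * (δ * n) * 1 :=
          add_le_add (mul_le_mul hs_sub hq1 hq0.le (by positivity))
            (mul_le_mul hlen_sub (hπ1 i) (hpos i).le (by positivity))
        _ = (c + 2) * δ * n := by ring
    rw [restrictedDistribution, div_sub_div _ _ hb0.ne' hq0.ne', abs_div,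
      abs_of_pos (mul_pos hb0 hq0), div_lt_iff₀ (mul_pos hb0 hq0)]
    refine hnum.trans_lt ?_
    have h3 := mul_lt_mul_of_pos_right hδε hn0
    have h4 : p / 2 * n * p ≤ b * q :=
      mul_le_mul (by linarith) hpq hp0.le hb0.le
    have h5 := mul_le_mul_of_nonneg_left h4 hε.le
    linarith

lemma IsMarkovChain.tendsto_notMem_supremusTypicalSet (hX : IsMarkovChain μ X P)
    (hP : IsIrreducible P) {π : S → ℝ} (hπ : IsInvariant P π) {ε : ℝ} (hε : 0 < ε) :
    Tendsto (fun n => μ.real {ω | block X n ω ∉ supremusTypicalSet P π ε n}) atTop (𝓝 0) := by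
  have h := (HoldsWhp.forall fun A : {A : Finset S // A.Nonempty} =>
    hX.whp_isStronglyTypical hP hπ A.2 hε)
  refine squeeze_zero' (Eventually.of_forall fun _ => measureReal_nonneg) ?_ h
  filter_upwards [eventually_ge_atTop (2 * Fintype.card S)] with n hn
  refine measureReal_mono (fun ω hω h => hω ⟨hn, fun A hA => h ⟨A, hA⟩⟩) (measure_ne_top _ _)

end Whp

end Probability

end SupremusTypicality

theorem mainTheorem3 {Ω S : Type*} [MeasurableSpace Ω] (μ : Measure Ω) [IsProbabilityMeasure μ]
    [Fintype S] [DecidableEq S] [MeasurableSpace S] [MeasurableSingletonClass S]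
    (X : ℤ → Ω → S) (P : Matrix S S ℝ) (π : S → ℝ)
    (hX : SupremusTypicality.IsMarkovChain μ X P)
    (hP : SupremusTypicality.IsIrreducible P)
    (hπ : SupremusTypicality.IsInvariant P π) :
    ∀ η : ℝ, 0 < η → ∃ ε₀ : ℝ, 0 < ε₀ ∧ ∃ N₀ : ℕ, 0 < N₀ ∧ ∀ ε : ℝ, 0 < ε → ε < ε₀ →
      (∀ n : ℕ, N₀ < n →
        (∀ x ∈ SupremusTypicality.supremusTypicalSet P π ε n,
          (0 < μ.real {ω | SupremusTypicality.block X n ω = x} →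
            (2 : ℝ) ^ (-(n : ℝ) * (SupremusTypicality.condEntropy P π + η)) <
              μ.real {ω | SupremusTypicality.block X n ω = x}) ∧
          μ.real {ω | SupremusTypicality.block X n ω = x} <
            (2 : ℝ) ^ (-(n : ℝ) * (SupremusTypicality.condEntropy P π - η))) ∧
        ((SupremusTypicality.supremusTypicalSet P π ε n).ncard : ℝ) <
          (2 : ℝ) ^ ((n : ℝ) * (SupremusTypicality.condEntropy P π + η))) ∧
      ∃ N₁ : ℕ, ∀ n : ℕ, N₁ < n →
        μ.real {ω | SupremusTypicality.block X n ω ∉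
          SupremusTypicality.supremusTypicalSet P π ε n} < η := by
  intro η hη
  obtain ⟨ω⟩ := nonempty_of_isProbabilityMeasure μ
  have : Nonempty S := ⟨X 0 ω⟩
  obtain ⟨Q, hQ, hQ0, hPQ⟩ := SupremusTypicality.exists_pos_stochastic hX.stochastic hπ.1
    (by positivity : 0 < η / 4)
  set L := ∑ i, ∑ j, |Real.logb 2 (P i j)| with hL
  set L' := ∑ i, ∑ j, |Real.logb 2 (Q i j)| with hL'
  have hL0 : 0 ≤ L := Finset.sum_nonneg fun _ _ => Finset.sum_nonneg fun _ _ => abs_nonneg _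
  have hL0' : 0 ≤ L' := Finset.sum_nonneg fun _ _ => Finset.sum_nonneg fun _ _ => abs_nonneg _
  set B := ∑ a, |Real.logb 2 (μ.real {ω | X 1 ω = a})| with hB
  set D := Real.logb 2 (Fintype.card S) with hD
  obtain ⟨N, hN⟩ := exists_nat_gt ((|B| + |D|) / (η / 4))
  rw [div_lt_iff₀ (by positivity)] at hN
  refine ⟨η / (4 * (L + L' + 1)), by positivity, N + 1, N.succ_pos, fun ε hε0 hε => ⟨?_, ?_⟩⟩
  · rw [lt_div_iff₀ (by positivity)] at hε
    have hεL : 2 * ε * L ≤ η / 2 := by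
      linarith [mul_nonneg hε0.le hL0']
    have hεL' : 2 * ε * L' ≤ η / 2 := by
      linarith [mul_nonneg hε0.le hL0]
    intro n hn
    have hNn : (N : ℝ) * (η / 4) ≤ n * (η / 4) :=
      mul_le_mul_of_nonneg_right (by exact_mod_cast (by omega : N ≤ n)) (by positivity)
    have hBn : B < n * (η / 2) := by
      linarith [le_abs_self B, abs_nonneg D, abs_nonneg B]
    have hDn : D < n * (η / 4) := by
      linarith [le_abs_self D, abs_nonneg B]
    exact ⟨fun x hx => hX.measureReal_block_bounds hπ hεL (by omega) hBn hx,
      SupremusTypicality.ncard_supremusTypicalSet_lt hX.stochastic hπ hQ hQ0 hPQ hεL' hDn⟩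
  · obtain ⟨N₁, hN₁⟩ := Filter.eventually_atTop.mp
      ((hX.tendsto_notMem_supremusTypicalSet hP hπ hε0).eventually_lt_const hη)
    exact ⟨N₁, fun n hn => hN₁ n hn.le⟩
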